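/- All Lie algebras are real and finite-dimensional. For $\alpha\in\mathfrak g^*$ put $d\alpha(x,y)=-\alpha([x,y])$, and for a linear map $T:\mathfrak g\to\mathfrak g$ put $N_T(x,y)=[Tx,Ty]+T^2[x,y]-T([Tx,y]+[x,Ty])$. A Sasakian structure on a Lie algebra $\mathfrak h$ is a quadruple $(\langle\cdot,\cdot\rangle,\phi,\xi,\eta)$ consisting of an inner product, an endomorphism $\phi$ of $\mathfrak h$, a vector $\xi\in\mathfrak h$ and a form $\eta\in\mathfrak h^*$ with $\eta(\xi)=1$, $\phi^2=-\mathrm{Id}+\eta\otimes\xi$, $\langle\phi x,\phi y\rangle=\langle x,y\rangle-\eta(x)\eta(y)$, $N_\phi=-d\eta\otimes\xi$ and $d\eta(x,y)=-\langle\phi x,y\rangle$ for all $x,y\in\mathfrak h$. (By rescaling, such a structure exists if and only if one exists with the normalization $d\eta(x,y)=2\langle\phi x,y\rangle$ in place of the last condition.) A Kähler flat Lie algebra is a triple $(\mathfrak k,J,\langle\cdot,\cdot\rangle)$ where $J^2=-\mathrm{Id}$, $N_J=0$, $\langle\cdot,\cdot\rangle$ is a $J$-Hermitian inner product whose fundamental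 form $\omega(x,y)=\langle Jx,y\rangle$ is closed, and the Levi-Civita connection of $\langle\cdot,\cdot\rangle$ on $\mathfrak k$ has zero curvature. The central extension $\mathfrak k_\beta(\xi)$ of $\mathfrak k$ by a closed $2$-form $\beta$ is $\mathbb R\xi\oplus\mathfrak k$ with $\xi$ central and $[x,y]_\beta=\beta(x,y)\xi+[x,y]_{\mathfrak k}$ for $x,y\in\mathfrak k$. Corollary. Let $\mathfrak h$ be a unimodular solvable Lie algebra (that is, solvable with $\operatorname{tr}(\operatorname{ad}_x)=0$ for all $x\in\mathfrak h$) that admits a Sasakian structure. Then the centre of $\mathfrak h$ is nontrivial, and $\mathfrak h$ is a central extension of a Kähler flat Lie algebra by its fundamental form: there is a Kähler flat Lie algebra $(\mathfrak k,J,\langle\cdot,\cdot\rangle)$ with fundamental form $\omega$ such that $\mathfrak h$ is isomorphic, as a Lie algebra, to $\mathfrak k_{\omega}(\xi)$. -/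

import Mathlib

universe u

namespace SasakiLie

/-- A real Lie algebra is unimodular if `tr (ad x) = 0` for all `x`. -/
def IsUnimodular (L : Type*) [LieRing L] [LieAlgebra ℝ L] : Prop :=
  ∀ x : L, LinearMap.trace ℝ L (LieAlgebra.ad ℝ L x) = 0

/-- An inner product on a real vector space: a symmetric positive definite bilinear form. -/
structure IsInnerProduct {V : Type*} [AddCommGroup V] [Module ℝ V]
    (g : LinearMap.BilinForm ℝ V) : Prop where
  symm : ∀ x y, g x y = g y x
  pos : ∀ x, x ≠ 0 → 0 < g x x

section

variable {L : Type*} [LieRing L] [LieAlgebra ℝ L]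

/-- The Chevalley-Eilenberg differential (trivial coefficients) of a 1-form:
`dα(x, y) = -α([x, y])`. -/
def d₁ (α : L →ₗ[ℝ] ℝ) (x y : L) : ℝ := -α ⁅x, y⁆

/-- The Chevalley-Eilenberg differential (trivial coefficients) of a 2-form:
`dω(x, y, z) = -ω([x, y], z) - ω([y, z], x) - ω([z, x], y)`. -/
def d₂ (ω : L → L → ℝ) (x y z : L) : ℝ := -ω ⁅x, y⁆ z - ω ⁅y, z⁆ x - ω ⁅z, x⁆ y

/-- The fundamental 2-form `(x, y) ↦ ⟨T x, y⟩` of an endomorphism `T` and a metric `g`. -/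
def fundamentalForm (g : LinearMap.BilinForm ℝ L) (T : L →ₗ[ℝ] L) (x y : L) : ℝ := g (T x) y

/-- The Nijenhuis tensor
`N_T(x, y) = [T x, T y] + T² [x, y] - T ([T x, y] + [x, T y])` of an endomorphism `T`. -/
def nijenhuis (T : L →ₗ[ℝ] L) (x y : L) : L :=
  ⁅T x, T y⁆ + T (T ⁅x, y⁆) - T (⁅T x, y⁆ + ⁅x, T y⁆)

/-- An almost contact metric structure `(g, φ, ξ, η)` on a Lie algebra. -/
structure IsAlmostContactMetric (g : LinearMap.BilinForm ℝ L) (φ : L →ₗ[ℝ] L) (ξ : L)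
    (η : L →ₗ[ℝ] ℝ) : Prop where
  inner : IsInnerProduct g
  eta_xi : η ξ = 1
  phi_sq : ∀ x, φ (φ x) = -x + η x • ξ
  compat : ∀ x y, g (φ x) (φ y) = g x y - η x * η y

/-- A Sasakian structure on a Lie algebra, normalized by `dη = -Φ`, where `Φ(x, y) = ⟨φ x, y⟩`:
a normal (`N_φ = -dη ⊗ ξ`) almost contact metric structure with `dη = -Φ`.
Replacing `(g, φ, ξ, η)` by `(g/4, φ, -2ξ, -η/2)` gives the normalization `dη = 2Φ`. -/
structure IsSasakian (g : LinearMap.BilinForm ℝ L) (φ : L →ₗ[ℝ] L) (ξ : L)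
    (η : L →ₗ[ℝ] ℝ) : Prop extends IsAlmostContactMetric g φ ξ η where
  normal : ∀ x y, nijenhuis φ x y = -(d₁ η x y • ξ)
  d_eta : ∀ x y, d₁ η x y = -fundamentalForm g φ x y

variable (L) in
/-- A Lie algebra admits a Sasakian structure. -/
def AdmitsSasakian : Prop :=
  ∃ (g : LinearMap.BilinForm ℝ L) (φ : L →ₗ[ℝ] L) (ξ : L) (η : L →ₗ[ℝ] ℝ), IsSasakian g φ ξ η

/-- A Kähler structure `(J, g)` on a Lie algebra: an integrable complex structure `J`, a Hermitian
inner product `g`, and a closed fundamental 2-form. -/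
structure IsKahler (g : LinearMap.BilinForm ℝ L) (J : L →ₗ[ℝ] L) : Prop where
  inner : IsInnerProduct g
  J_sq : ∀ x, J (J x) = -x
  integrable : ∀ x y, nijenhuis J x y = 0
  hermitian : ∀ x y, g (J x) (J y) = g x y
  closed : ∀ x y z, d₂ (fundamentalForm g J) x y z = 0

/-- `D x y = ∇_x y` is the Levi-Civita connection of the metric `g` on a Lie algebra (the
left-invariant one on the group): it is torsion-free and metric. -/
structure IsLeviCivita (g : LinearMap.BilinForm ℝ L) (D : L →ₗ[ℝ] L →ₗ[ℝ] L) : Prop where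
  torsion_free : ∀ x y, D x y - D y x = ⁅x, y⁆
  metric : ∀ x y z, g (D x y) z + g y (D x z) = 0

/-- The metric `g` is flat: the curvature of its Levi-Civita connection vanishes. -/
def IsFlat (g : LinearMap.BilinForm ℝ L) : Prop :=
  ∃ D : L →ₗ[ℝ] L →ₗ[ℝ] L, IsLeviCivita g D ∧
    ∀ x y z, D x (D y z) - D y (D x z) - D ⁅x, y⁆ z = 0

end

/-- Closed real 2-forms on a Lie algebra: alternating bilinear forms that are cocycles for the
trivial representation on `ℝ`. -/
abbrev ClosedTwoForm (L : Type*) [LieRing L] [LieAlgebra ℝ L] :=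
  LieModule.Cohomology.twoCocycle ℝ L (TrivialLieModule ℝ L ℝ)

/-- The real-valued function of two arguments underlying a closed 2-form. -/
def ClosedTwoForm.eval {L : Type*} [LieRing L] [LieAlgebra ℝ L] (β : ClosedTwoForm L)
    (x y : L) : ℝ :=
  TrivialLieModule.equiv ℝ L ℝ (β.1.1 x y)

/-- The central extension of `L` by the closed 2-form `β`, i.e. `L × ℝ` with the bracket
`[(x, a), (y, b)] = ([x, y], β(x, y))`. -/
abbrev CentralExtension {L : Type*} [LieRing L] [LieAlgebra ℝ L] (β : ClosedTwoForm L) :=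
  LieAlgebra.ofTwoCocycle β

end SasakiLie

namespace SasakiLie

/-! ### Orthonormal bases adapted to a filtration -/

section InnerProduct

/-! The Reeb vector ξ is central, and dividing by it leaves a Kähler algebra with ω(x, y) = η([sx,
sy]), where s lifts to ker η. Thus 𝔥 is the extension of the quotient by ω, and it remains to see
that a unimodular solvable Kähler algebra is flat (Hano).

Centrality (`IsSasakian.lie_xi`): normality and the Jacobi identity make ad ξ skew. If ξ lies in the
derived algebra, Lie's theorem makes ad ξ nilpotent, and a skew nilpotent map is zero. Otherwise
some closed 1-form α has α(ξ) = 1; then η - α is the contraction of dη with a vector, up to sign,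
whose adjoint action scales dη. Unimodularity forbids this unless φ = 0, and then 𝔥 = ℝξ.

Flatness (`IsKahler.isFlat`): tracing J against the curvature shows that the scalar curvature
vanishes (`IsKahler.scalar_curvature`). By `IsKoszul.scalar_eq` it is also a cyclic quadratic sum in
the connection coefficients. In an orthonormal basis adapted to the derived series every cyclic
group of terms is minus a square, so each vanishes (`level_lt_of_sum_eq_zero`). The surviving
coefficients are so few that the curvature reduces to the Jacobi identity
(`IsLeviCivita.isFlat_of_level`). -/

theorem exists_orthonormalBasis_adapted {E : Type*} [NormedAddCommGroup E] [InnerProductSpace ℝ E]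
    [FiniteDimensional ℝ E] (W : ℕ → Submodule ℝ E) (hanti : Antitone W) (h0 : W 0 = ⊤)
    {N : ℕ} (hN : W N = ⊥) :
    ∃ (ι : Type) (_ : Fintype ι) (b : OrthonormalBasis ι ℝ E) (ℓ : ι → ℕ),
      (∀ i, b i ∈ W (ℓ i)) ∧ ∀ i, ∀ w ∈ W (ℓ i + 1), inner ℝ (b i) w = 0 := by
  classical
  -- The orthogonal complement of each filtration step in the preceding one; these sum orthogonally
  -- to the whole space.
  let A : Fin N → Submodule ℝ E := fun p ↦ (W (p + 1))ᗮ ⊓ W p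
  have hA : OrthogonalFamily ℝ (fun p ↦ A p) fun p ↦ (A p).subtypeₗᵢ := by
    refine OrthogonalFamily.of_pairwise ?_
    have key : ∀ p q : Fin N, p < q → A p ⟂ A q := by
      intro p q hpq
      rw [Submodule.isOrtho_iff_le]
      refine inf_le_left.trans (Submodule.orthogonal_le (inf_le_right.trans (hanti ?_)))
      exact hpq
    intro p q hpq
    rcases lt_or_gt_of_ne hpq with h | h
    · exact key p q h
    · exact (key q p h).symm
  have hsup : ∀ k, k ≤ N → W (N - k) ≤ iSup A := by
    intro k
    induction k with
    | zero => intro _; simp [hN]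
    | succ k ih =>
      intro hk
      have hlt : N - (k + 1) < N := by omega
      have hs : N - (k + 1) + 1 = N - k := by omega
      rw [← Submodule.sup_orthogonal_inf_of_hasOrthogonalProjection (hanti (Nat.le_succ (N - (k + 1))))]
      refine sup_le ?_ (le_iSup A ⟨N - (k + 1), hlt⟩)
      rw [Nat.succ_eq_add_one, hs]
      exact ih (by omega)
  have hint : DirectSum.IsInternal A := by
    rw [hA.isInternal_iff]
    have := hsup N le_rfl
    rw [Nat.sub_self, h0, top_le_iff] at this
    rw [this, Submodule.top_orthogonal_eq_bot]
  let b := hint.collectedOrthonormalBasis hA fun p ↦ stdOrthonormalBasis ℝ (A p)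
  have hb : ∀ i, b i ∈ A i.1 := hint.collectedOrthonormalBasis_mem hA _
  refine ⟨_, inferInstance, b, fun i ↦ i.1, fun i ↦ (hb i).2, fun i w hw ↦ ?_⟩
  rw [real_inner_comm]
  exact (hb i).1 w hw

variable {V : Type*} [AddCommGroup V] [Module ℝ V] {g : LinearMap.BilinForm ℝ V}

/-- The basis `b` is orthonormal for the bilinear form `g`. -/
def IsOrthonormalBasis (g : LinearMap.BilinForm ℝ V) {ι : Type*} (b : Module.Basis ι ℝ V) : Prop :=
  (∀ i, g (b i) (b i) = 1) ∧ ∀ i j, i ≠ j → g (b i) (b j) = 0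

theorem IsInnerProduct.exists_adapted_basis [FiniteDimensional ℝ V] (hg : IsInnerProduct g)
    (W : ℕ → Submodule ℝ V) (hanti : Antitone W) (h0 : W 0 = ⊤) {N : ℕ} (hN : W N = ⊥) :
    ∃ (ι : Type) (_ : Fintype ι) (b : Module.Basis ι ℝ V) (ℓ : ι → ℕ), IsOrthonormalBasis g b ∧
      (∀ i, b i ∈ W (ℓ i)) ∧ ∀ i, ∀ w ∈ W (ℓ i + 1), g (b i) w = 0 := by
  let core : InnerProductSpace.Core ℝ V :=
    { inner := fun x y ↦ g x y
      conj_inner_symm := fun x y ↦ hg.symm y x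
      re_inner_nonneg := fun x ↦ by
        rcases eq_or_ne x 0 with rfl | hx
        · simp
        · exact (hg.pos x hx).le
      add_left := fun x y z ↦ by simp
      smul_left := fun x y r ↦ by simp
      definite := fun x hx ↦ by
        by_contra h
        exact (hg.pos x h).ne' hx }
  let _ : NormedAddCommGroup V := core.toNormedAddCommGroup
  let _ : InnerProductSpace ℝ V := InnerProductSpace.ofCore core.toCore
  obtain ⟨ι, hι, b, ℓ, h1, h2⟩ := exists_orthonormalBasis_adapted W hanti h0 hN
  refine ⟨ι, hι, b.toBasis, ℓ, ⟨fun i ↦ ?_, fun i j hij ↦ ?_⟩, fun i ↦ ?_, fun i w hw ↦ ?_⟩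
  · rw [b.coe_toBasis]
    exact (real_inner_self_eq_norm_sq (b i)).trans (by simp)
  · rw [b.coe_toBasis]
    exact b.inner_eq_zero hij
  · rw [b.coe_toBasis]
    exact h1 i
  · rw [b.coe_toBasis]
    exact h2 i w hw

theorem IsInnerProduct.exists_basis [FiniteDimensional ℝ V] (hg : IsInnerProduct g) :
    ∃ (ι : Type) (_ : Fintype ι) (b : Module.Basis ι ℝ V), IsOrthonormalBasis g b := by
  obtain ⟨ι, hι, b, -, hb, -⟩ := hg.exists_adapted_basis (fun n ↦ if n = 0 then ⊤ else ⊥)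
    (fun m n h ↦ by
      rcases Nat.eq_zero_or_pos m with rfl | hm
      · simp
      · simp [hm.ne', (hm.trans_le h).ne']) (by simp) (N := 1) (by simp)
  exact ⟨ι, hι, b, hb⟩

theorem IsInnerProduct.eq_zero_of_self (hg : IsInnerProduct g) {x : V} (h : g x x = 0) : x = 0 := by
  by_contra hx
  exact (hg.pos x hx).ne' h

theorem IsInnerProduct.self_nonneg (hg : IsInnerProduct g) (x : V) : 0 ≤ g x x := by
  rcases eq_or_ne x 0 with rfl | hx
  · simp
  · exact (hg.pos x hx).le

theorem IsInnerProduct.ext (hg : IsInnerProduct g) {x y : V} (h : ∀ z, g x z = g y z) :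
    x = y := by
  rw [← sub_eq_zero]
  apply hg.eq_zero_of_self
  simp only [map_sub, LinearMap.sub_apply]
  linarith [h x, h y]

variable {ι : Type*} [Fintype ι] {b : Module.Basis ι ℝ V}

theorem IsOrthonormalBasis.repr_eq (hb : IsOrthonormalBasis g b) (x : V) (i : ι) :
    b.repr x i = g (b i) x := by
  conv_rhs => rw [← b.sum_repr x]
  rw [map_sum, Finset.sum_eq_single i]
  · simp [hb.1 i]
  · intro j _ hj
    simp [hb.2 i j hj.symm]
  · simp

theorem IsOrthonormalBasis.sum_smul (hb : IsOrthonormalBasis g b) (x : V) :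
    ∑ i, g (b i) x • b i = x := by
  simp_rw [← hb.repr_eq]
  exact b.sum_repr x

theorem IsOrthonormalBasis.sum_mul (hb : IsOrthonormalBasis g b) (x y : V) :
    ∑ i, g (b i) x * g (b i) y = g x y := by
  conv_rhs => rw [← hb.sum_smul x]
  simp [map_sum, LinearMap.sum_apply]

theorem IsOrthonormalBasis.trace_eq (hb : IsOrthonormalBasis g b) (T : V →ₗ[ℝ] V) :
    LinearMap.trace ℝ V T = ∑ i, g (b i) (T (b i)) := by
  classical
  rw [LinearMap.trace_eq_matrix_trace ℝ b, Matrix.trace]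
  refine Finset.sum_congr rfl fun i _ ↦ ?_
  rw [Matrix.diag_apply, LinearMap.toMatrix_apply, hb.repr_eq]

/-- The matrix of a skew map is antisymmetric, so exchanging the two summation indices costs a sign.
-/
theorem IsOrthonormalBasis.sum_skew (hb : IsOrthonormalBasis g b) {T : V →ₗ[ℝ] V}
    (hT : ∀ x y, g (T x) y = -g x (T y)) (hg : IsInnerProduct g) (B : V →ₗ[ℝ] V →ₗ[ℝ] ℝ) :
    ∑ i, B (T (b i)) (b i) = -∑ i, B (b i) (T (b i)) := by
  have h1 : ∀ i, B (T (b i)) (b i) = ∑ k, g (b k) (T (b i)) * B (b k) (b i) := by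
    intro i
    conv_lhs => rw [← hb.sum_smul (T (b i))]
    simp [map_sum, LinearMap.sum_apply]
  have h2 : ∀ k, B (b k) (T (b k)) = ∑ i, g (b i) (T (b k)) * B (b k) (b i) := by
    intro k
    conv_lhs => rw [← hb.sum_smul (T (b k))]
    simp [map_sum]
  simp_rw [h1, h2]
  rw [Finset.sum_comm, ← Finset.sum_neg_distrib]
  refine Finset.sum_congr rfl fun k _ ↦ ?_
  rw [← Finset.sum_neg_distrib]
  refine Finset.sum_congr rfl fun i _ ↦ ?_
  rw [hg.symm (b k), hT]
  ring

end InnerProduct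
-- Nilpotency from Lie's theorem
section Nilpotent

/-- Lie's theorem gives a nonzero weight space. Its weight kills commutators, so `x` acts there by
zero, and the quotient module has smaller dimension. -/
theorem isNilpotent_toEnd_of_mem_derivedSeries_one {k L : Type*} [Field k] [CharZero k]
    [IsAlgClosed k] [LieRing L] [LieAlgebra k L] [LieAlgebra.IsSolvable L] {x : L}
    (hx : x ∈ LieAlgebra.derivedSeries k L 1) (n : ℕ) :
    ∀ (V : Type u) [AddCommGroup V] [Module k V] [FiniteDimensional k V] [LieRingModule L V]
      [LieModule k L V], Module.finrank k V ≤ n → IsNilpotent (LieModule.toEnd k L V x) := by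
  induction n with
  | zero =>
    intro V _ _ _ _ _ hV
    have := Module.finrank_zero_iff.mp (Nat.le_zero.mp hV)
    exact ⟨1, LinearMap.ext fun v ↦ Subsingleton.elim _ _⟩
  | succ n ih =>
    intro V _ _ _ _ _ hV
    rcases subsingleton_or_nontrivial V with h | h
    · exact ⟨1, LinearMap.ext fun v ↦ Subsingleton.elim _ _⟩
    obtain ⟨χ, hχ⟩ := LieModule.exists_nontrivial_weightSpace_of_isSolvable k L V
    set N : LieSubmodule k L V := LieModule.weightSpace V χ with hN
    have hact : ∀ y : L, ∀ v ∈ N, ⁅y, v⁆ = χ y • v := fun y v hv ↦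
      (LieModule.mem_weightSpace _ _).mp hv y
    have hχx : χ x = 0 := by
      obtain ⟨⟨v, hv⟩, hv0⟩ := exists_ne (0 : N)
      have hv0' : v ≠ 0 := fun h ↦ hv0 (Subtype.ext h)
      have hle : (LieAlgebra.derivedSeries k L 1).toSubmodule ≤ LinearMap.ker χ := by
        refine (LieAlgebra.coe_derivedSeries_one_eq k L).trans_le (Submodule.span_le.mpr ?_)
        rintro _ ⟨y, z, rfl⟩
        have h1 := hact ⁅y, z⁆ v hv
        rw [lie_lie, hact z v hv, hact y v hv, lie_smul, lie_smul, hact z v hv, hact y v hv,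
          smul_comm, sub_self] at h1
        exact (smul_eq_zero.mp h1.symm).resolve_right hv0'
      exact hle hx
    have hlt : Module.finrank k (V ⧸ N) ≤ n := by
      have h1 := Submodule.finrank_quotient_add_finrank N.toSubmodule
      have h2 : 0 < Module.finrank k N.toSubmodule := Module.finrank_pos_iff.mpr hχ
      have h3 : Module.finrank k (V ⧸ N) = Module.finrank k (V ⧸ N.toSubmodule) := rfl
      omega
    obtain ⟨m, hm⟩ := ih (V ⧸ N) hlt
    refine ⟨m + 1, LinearMap.ext fun v ↦ ?_⟩
    have hcomm : ∀ (j : ℕ) (w : V), LieSubmodule.Quotient.mk (N := N)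
        ((LieModule.toEnd k L V x ^ j) w) =
        (LieModule.toEnd k L (V ⧸ N) x ^ j) (LieSubmodule.Quotient.mk w) := by
      intro j
      induction j with
      | zero => intro w; rfl
      | succ j ihj =>
        intro w
        rw [pow_succ, pow_succ, Module.End.mul_apply, Module.End.mul_apply, ihj]
        rfl
    have hmem : (LieModule.toEnd k L V x ^ m) v ∈ N := by
      rw [← LieSubmodule.Quotient.mk_eq_zero', hcomm, hm]
      rfl
    rw [pow_succ', Module.End.mul_apply, LieModule.toEnd_apply_apply, hact x _ hmem, hχx, zero_smul]
    rfl

open TensorProduct in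
/-- In a solvable real Lie algebra, `ad x` is nilpotent for `x` in the derived algebra. -/
theorem isNilpotent_ad_of_mem_derivedSeries_one {L : Type*} [LieRing L] [LieAlgebra ℝ L]
    [FiniteDimensional ℝ L] [LieAlgebra.IsSolvable L] {x : L}
    (hx : x ∈ LieAlgebra.derivedSeries ℝ L 1) : IsNilpotent (LieAlgebra.ad ℝ L x) := by
  -- Lie's theorem requires an algebraically closed field; nilpotency descends from ℂ because z ↦ 1
  -- ⊗ z is injective.
  have h1 : (1 : ℂ) ⊗ₜ[ℝ] x ∈ LieAlgebra.derivedSeries ℂ (ℂ ⊗[ℝ] L) 1 := by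
    rw [LieAlgebra.derivedSeries_baseChange]
    exact LieSubmodule.tmul_mem_baseChange_of_mem 1 hx
  obtain ⟨m, hm⟩ := isNilpotent_toEnd_of_mem_derivedSeries_one h1 _ (ℂ ⊗[ℝ] L) le_rfl
  refine ⟨m, LinearMap.ext fun y ↦ ?_⟩
  rw [LieModule.toEnd_baseChange, ← LinearMap.baseChange_pow] at hm
  have h2 := LinearMap.congr_fun hm ((1 : ℂ) ⊗ₜ[ℝ] y)
  rw [LinearMap.baseChange_tmul, LinearMap.zero_apply] at h2
  have hinj : Function.Injective (fun z : L ↦ (1 : ℂ) ⊗ₜ[ℝ] z) :=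
    Module.Flat.tensorProduct_mk_injective (R := ℝ) (S := ℂ) (M := L)
  refine hinj (h2.trans ?_)
  simp

end Nilpotent
-- Levi-Civita connection and scalar curvature
section Flat

variable {L : Type*} [LieRing L] [LieAlgebra ℝ L] {g : LinearMap.BilinForm ℝ L}

/-- The Koszul formula for the Levi-Civita connection of a metric on a Lie algebra. -/
def IsKoszul (g : LinearMap.BilinForm ℝ L) (D : L →ₗ[ℝ] L →ₗ[ℝ] L) : Prop :=
  ∀ x y z, 2 * g (D x y) z = g ⁅x, y⁆ z - g ⁅y, z⁆ x + g ⁅z, x⁆ y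

theorem IsInnerProduct.exists_isKoszul [FiniteDimensional ℝ L] (hg : IsInnerProduct g) :
    ∃ D : L →ₗ[ℝ] L →ₗ[ℝ] L, IsKoszul g D := by
  obtain ⟨ι, _, b, hb⟩ := hg.exists_basis
  refine ⟨LinearMap.mk₂ ℝ (fun x y ↦ ∑ k,
    ((1 / 2 : ℝ) * (g ⁅x, y⁆ (b k) - g ⁅y, b k⁆ x + g ⁅b k, x⁆ y)) • b k) ?_ ?_ ?_ ?_, ?_⟩
  · intro x x' y
    rw [← Finset.sum_add_distrib]
    refine Finset.sum_congr rfl fun k _ ↦ ?_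
    rw [← add_smul]
    congr 1
    simp only [add_lie, lie_add, map_add, LinearMap.add_apply]
    ring
  · intro c x y
    rw [Finset.smul_sum]
    refine Finset.sum_congr rfl fun k _ ↦ ?_
    rw [smul_smul]
    congr 1
    simp only [smul_lie, lie_smul, map_smul, LinearMap.smul_apply, smul_eq_mul]
    ring
  · intro x y y'
    rw [← Finset.sum_add_distrib]
    refine Finset.sum_congr rfl fun k _ ↦ ?_
    rw [← add_smul]
    congr 1
    simp only [add_lie, lie_add, map_add, LinearMap.add_apply]
    ring
  · intro c x y
    rw [Finset.smul_sum]
    refine Finset.sum_congr rfl fun k _ ↦ ?_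
    rw [smul_smul]
    congr 1
    simp only [smul_lie, lie_smul, map_smul, LinearMap.smul_apply, smul_eq_mul]
    ring
  · intro x y z
    have hz : g ⁅x, y⁆ z - g ⁅y, z⁆ x + g ⁅z, x⁆ y =
        ∑ k, g (b k) z * (g ⁅x, y⁆ (b k) - g ⁅y, b k⁆ x + g ⁅b k, x⁆ y) := by
      conv_lhs => rw [← hb.sum_smul z]
      simp only [map_sum, lie_sum, sum_lie, LinearMap.sum_apply, map_smul, lie_smul, smul_lie,
        LinearMap.smul_apply, smul_eq_mul]
      rw [← Finset.sum_sub_distrib, ← Finset.sum_add_distrib]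
      exact Finset.sum_congr rfl fun k _ ↦ by ring
    rw [hz, LinearMap.mk₂_apply, map_sum, LinearMap.sum_apply, Finset.mul_sum]
    refine Finset.sum_congr rfl fun k _ ↦ ?_
    rw [map_smul, LinearMap.smul_apply, smul_eq_mul]
    ring

variable {D : L →ₗ[ℝ] L →ₗ[ℝ] L}

theorem IsKoszul.isLeviCivita (hg : IsInnerProduct g) (hD : IsKoszul g D) :
    IsLeviCivita g D where
  torsion_free x y := by
    refine hg.ext fun z ↦ ?_
    have h1 := hD x y z
    have h2 := hD y x z
    rw [← lie_skew y x, ← lie_skew x z, ← lie_skew z y] at h2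
    simp only [map_sub, map_neg, LinearMap.sub_apply, LinearMap.neg_apply] at h1 h2 ⊢
    linarith
  metric x y z := by
    have h1 := hD x y z
    have h2 := hD x z y
    rw [hg.symm y]
    rw [← lie_skew x z, ← lie_skew z y, ← lie_skew y x] at h2
    simp only [map_neg, LinearMap.neg_apply] at h1 h2
    linarith

/-- The curvature operator `R(x, y) = [D_x, D_y] - D_[x, y]` of a connection `D`. -/
def curvature (D : L →ₗ[ℝ] L →ₗ[ℝ] L) (x y : L) : L →ₗ[ℝ] L :=
  D x ∘ₗ D y - D y ∘ₗ D x - D ⁅x, y⁆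

theorem curvature_apply (D : L →ₗ[ℝ] L →ₗ[ℝ] L) (x y z : L) :
    curvature D x y z = D x (D y z) - D y (D x z) - D ⁅x, y⁆ z := rfl

theorem curvature_skew (D : L →ₗ[ℝ] L →ₗ[ℝ] L) (x y z : L) :
    curvature D x y z = -curvature D y x z := by
  simp only [curvature_apply]
  rw [← lie_skew y x, map_neg, LinearMap.neg_apply]
  abel

/-- Vanishing torsion rewrites D_[x,y] z so that the terms quadratic in D cancel cyclically, leaving
the Jacobi identity. -/
theorem IsLeviCivita.bianchi (hD : IsLeviCivita g D) (x y z : L) :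
    curvature D x y z + curvature D y z x + curvature D z x y = 0 := by
  have h : ∀ x y z, D ⁅x, y⁆ z = ⁅⁅x, y⁆, z⁆ + D z (D x y) - D z (D y x) := by
    intro x y z
    rw [add_sub_assoc, ← map_sub, hD.torsion_free x y, ← hD.torsion_free ⁅x, y⁆ z]
    abel
  have hj : ⁅⁅x, y⁆, z⁆ + ⁅⁅y, z⁆, x⁆ + ⁅⁅z, x⁆, y⁆ = 0 := by
    rw [← lie_skew ⁅x, y⁆ z, ← lie_skew ⁅y, z⁆ x, ← lie_skew ⁅z, x⁆ y, ← neg_eq_zero,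
      ← lie_jacobi x y z]
    abel
  simp only [curvature_apply, h]
  rw [← neg_eq_zero, ← hj]
  abel

/-! ### Kähler Lie algebras -/

variable {J : L →ₗ[ℝ] L}

theorem IsKahler.skew (hK : IsKahler g J) (x y : L) : g (J x) y = -g x (J y) := by
  have := hK.hermitian x (J y)
  rw [hK.J_sq, map_neg] at this
  linarith

/-- The Levi-Civita connection of a Kähler Lie algebra commutes with the complex structure. -/
theorem IsKahler.parallel (hK : IsKahler g J) (hD : IsKoszul g D) (x y : L) :
    D x (J y) = J (D x y) := by
  refine hK.inner.ext fun z ↦ ?_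
  -- The classical formula for ∇J: two Koszul formulas combined with dω at (x, y, z) and (x, Jy, Jz)
  -- and with the Nijenhuis tensor at (y, z).
  have h1 := hD x (J y) z
  have h2 := hD x y (J z)
  have c1 := hK.closed x y z
  have c2 := hK.closed x (J y) (J z)
  have hN := congrArg (fun v ↦ g v (J x)) (hK.integrable y z)
  simp only [nijenhuis, d₂, fundamentalForm, hK.J_sq, hK.skew] at c1 c2 hN ⊢
  simp only [map_neg, map_add, map_sub, LinearMap.add_apply, LinearMap.sub_apply,
    LinearMap.neg_apply, LinearMap.zero_apply, map_zero, hK.hermitian] at c1 c2 hN h1 h2 ⊢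
  linarith

theorem trace_comp_comp (A B C : L →ₗ[ℝ] L) :
    LinearMap.trace ℝ L (A ∘ₗ B ∘ₗ C) = LinearMap.trace ℝ L (B ∘ₗ C ∘ₗ A) :=
  LinearMap.trace_mul_comm ℝ A (B ∘ₗ C)

variable {ι : Type*} [Fintype ι] {b : Module.Basis ι ℝ L}

/-- Summing dω(bᵢ, Jbᵢ, w) = 0 expresses the pairing of J of this vector with w as tr(J ad_w J) -
tr(ad_w), and both traces vanish. -/
theorem IsKahler.sum_lie_eq_zero (hK : IsKahler g J) (hu : IsUnimodular L)
    (hb : IsOrthonormalBasis g b) : ∑ i, ⁅b i, J (b i)⁆ = 0 := by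
  have key : ∀ w, g (J (∑ i, ⁅b i, J (b i)⁆)) w = 0 := by
    intro w
    have h1 : ∑ i, g (b i) ⁅w, b i⁆ = 0 := by
      have := hu w
      rwa [hb.trace_eq] at this
    have h2 : ∑ i, g (b i) (J ⁅w, J (b i)⁆) = 0 := by
      have h3 : LinearMap.trace ℝ L (J ∘ₗ LieAlgebra.ad ℝ L w ∘ₗ J) = 0 := by
        have h4 : J ∘ₗ J = -LinearMap.id := LinearMap.ext hK.J_sq
        rw [trace_comp_comp, h4, LinearMap.comp_neg, LinearMap.comp_id, map_neg, hu w, neg_zero]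
      rwa [hb.trace_eq] at h3
    have h3 : ∀ i, g (J ⁅b i, J (b i)⁆) w =
        g (b i) (J ⁅w, J (b i)⁆) - g (b i) ⁅w, b i⁆ := by
      intro i
      have := hK.closed (b i) (J (b i)) w
      simp only [d₂, fundamentalForm] at this
      rw [hK.hermitian, ← lie_skew (J (b i)) w, map_neg, map_neg, LinearMap.neg_apply,
        hK.inner.symm _ (b i), hK.inner.symm _ (b i)] at this
      linarith
    rw [map_sum, map_sum, LinearMap.sum_apply, Finset.sum_congr rfl fun i _ ↦ h3 i,
      Finset.sum_sub_distrib, h1, h2, sub_zero]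
  have h0 : J (∑ i, ⁅b i, J (b i)⁆) = 0 := hK.inner.eq_zero_of_self (key _)
  rw [← neg_eq_zero, ← hK.J_sq, h0, map_zero]

/-- Since J commutes with every D_x, the commutator part has zero trace against J. What remains is
linear in [x, y], and the brackets [bᵢ, Jbᵢ] sum to zero. -/
theorem IsKahler.sum_trace_curvature (hK : IsKahler g J) (hu : IsUnimodular L)
    (hD : IsKoszul g D) (hb : IsOrthonormalBasis g b) :
    ∑ i, LinearMap.trace ℝ L (J ∘ₗ curvature D (b i) (J (b i))) = 0 := by
  have hJ : ∀ x, D x ∘ₗ J = J ∘ₗ D x := fun x ↦ LinearMap.ext (hK.parallel hD x)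
  have h : ∀ x y, LinearMap.trace ℝ L (J ∘ₗ curvature D x y) =
      -LinearMap.trace ℝ L (J ∘ₗ D ⁅x, y⁆) := by
    intro x y
    have h1 : LinearMap.trace ℝ L (J ∘ₗ D x ∘ₗ D y) = LinearMap.trace ℝ L (J ∘ₗ D y ∘ₗ D x) := by
      rw [trace_comp_comp, hJ, trace_comp_comp]
    rw [curvature, LinearMap.comp_sub, LinearMap.comp_sub, map_sub, map_sub, h1, sub_self,
      zero_sub]
  have hs : ∑ i, J ∘ₗ D ⁅b i, J (b i)⁆ = J ∘ₗ D (∑ i, ⁅b i, J (b i)⁆) :=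
    LinearMap.ext fun z ↦ by simp [LinearMap.sum_apply]
  simp_rw [h]
  rw [Finset.sum_neg_distrib, ← map_sum, hs, hK.sum_lie_eq_zero hu hb]
  simp

/-- The scalar curvature of a unimodular Kähler Lie algebra vanishes. -/
theorem IsKahler.scalar_curvature (hK : IsKahler g J) (hu : IsUnimodular L)
    (hD : IsKoszul g D) (hb : IsOrthonormalBasis g b) :
    ∑ j, ∑ i, g (b j) (curvature D (b j) (b i) (b i)) = 0 := by
  have hLC := hD.isLeviCivita hK.inner
  have hRJ : ∀ x y z, curvature D x y (J z) = J (curvature D x y z) := by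
    intro x y z
    simp only [curvature_apply, hK.parallel hD, map_sub]
  -- Bianchi turns the trace with J into two Ricci-type terms; replacing the frame Jbᵢ by bᵢ makes
  -- their sums equal, giving twice the scalar curvature.
  have h1 : ∀ x y, g y (J (curvature D x (J x) y)) =
      g y (curvature D y (J x) (J x)) + g y (curvature D y x x) := by
    intro x y
    have hB := hLC.bianchi x (J x) y
    rw [curvature_skew D (J x) y, hRJ] at hB
    have h2 : curvature D x (J x) y = curvature D y (J x) x - J (curvature D y x x) := by
      rw [← sub_eq_zero, ← hB]
      abel
    rw [h2, map_sub, hK.J_sq, hRJ, map_sub, map_neg, sub_neg_eq_add]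
  have h2 : ∀ y, ∑ i, g y (curvature D y (J (b i)) (J (b i))) =
      ∑ i, g y (curvature D y (b i) (b i)) := by
    intro y
    let B : L →ₗ[ℝ] L →ₗ[ℝ] ℝ := LinearMap.mk₂ ℝ (fun u v ↦ g y (curvature D y u v))
      (fun u u' v ↦ by
        simp only [curvature_apply, lie_add, map_add, map_sub, LinearMap.add_apply]; ring)
      (fun c u v ↦ by
        simp only [curvature_apply, lie_smul, map_smul, map_sub, LinearMap.smul_apply,
          smul_eq_mul]; ring)
      (fun u v v' ↦ by simp only [map_add])
      (fun c u v ↦ by simp only [map_smul])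
    have := hb.sum_skew hK.skew hK.inner (B.compl₂ J)
    simpa [B, LinearMap.compl₂_apply, hK.J_sq] using this
  have h3 := hK.sum_trace_curvature hu hD hb
  simp_rw [hb.trace_eq, LinearMap.comp_apply, h1] at h3
  rw [Finset.sum_comm] at h3
  simp_rw [Finset.sum_add_distrib, h2] at h3
  rw [← Finset.sum_add_distrib] at h3
  simp_rw [← two_mul] at h3
  rw [← Finset.mul_sum] at h3
  linarith

theorem sum_cyclic {ι : Type*} [Fintype ι] (f : ι → ι → ι → ℝ) :
    ∑ i, ∑ j, ∑ k, f j k i = ∑ i, ∑ j, ∑ k, f i j k := by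
  rw [Finset.sum_comm]
  refine Finset.sum_congr rfl fun j _ ↦ ?_
  rw [Finset.sum_comm]

/-- The scalar curvature of a unimodular metric Lie algebra in terms of connection coefficients. -/
theorem IsKoszul.scalar_eq (hg : IsInnerProduct g) (hu : IsUnimodular L)
    (hD : IsKoszul g D) (hb : IsOrthonormalBasis g b) :
    ∑ j, ∑ i, g (b j) (curvature D (b j) (b i) (b i)) =
      ∑ i, ∑ j, ∑ k, g (D (b i) (b j)) (b k) * g (D (b j) (b k)) (b i) := by
  have hLC := hD.isLeviCivita hg
  set w : ι → ι → ι → ℝ := fun i j k ↦ g (D (b i) (b j)) (b k) with hw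
  have hskew : ∀ x y z, g y (D x z) = -g (D x y) z := fun x y z ↦ by
    linarith [hLC.metric x y z]
  have hwskew : ∀ i j k, w i j k = -w i k j := fun i j k ↦ by
    have := hskew (b i) (b k) (b j)
    rw [hg.symm] at this
    exact this
  -- By Koszul, pairing this vector with z gives tr(ad_z); this is where unimodularity enters.
  have hH : ∑ i, D (b i) (b i) = 0 := by
    refine hg.ext fun z ↦ ?_
    have h1 : ∀ i, g (D (b i) (b i)) z = g (b i) ⁅z, b i⁆ := by
      intro i
      have h2 := hD (b i) (b i) z
      rw [lie_self, ← lie_skew (b i) z] at h2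
      simp only [map_zero, LinearMap.zero_apply, map_neg, LinearMap.neg_apply] at h2
      linarith [hg.symm ⁅z, b i⁆ (b i)]
    rw [map_sum, LinearMap.sum_apply, Finset.sum_congr rfl fun i _ ↦ h1 i]
    have := hu z
    rw [hb.trace_eq] at this
    simpa using this
  have hDexp : ∀ x (i j : ι), g (b j) (D x (b i)) = ∑ k, g (b k) x * w k i j := by
    intro x i j
    conv_lhs => rw [← hb.sum_smul x]
    rw [map_sum, LinearMap.sum_apply, map_sum]
    refine Finset.sum_congr rfl fun k _ ↦ ?_
    rw [map_smul, LinearMap.smul_apply, map_smul, smul_eq_mul, hg.symm (b j)]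
  have hterm : ∀ j i, g (b j) (curvature D (b j) (b i) (b i)) =
      -g (D (b j) (b j)) (D (b i) (b i)) +
      ∑ k, (w i j k * w j i k - w j i k * w k i j + w i j k * w k i j) := by
    intro j i
    have e1 : g (b j) (D (b i) (D (b j) (b i))) = -∑ k, w i j k * w j i k := by
      rw [hskew, ← hb.sum_mul]
      congr 1
      refine Finset.sum_congr rfl fun k _ ↦ ?_
      rw [hg.symm (b k), hg.symm (b k)]
    have e2 : g (b j) (D ⁅b j, b i⁆ (b i)) = ∑ k, (w j i k - w i j k) * w k i j := by
      rw [hDexp]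
      refine Finset.sum_congr rfl fun k _ ↦ ?_
      rw [← hLC.torsion_free, map_sub, hg.symm (b k), hg.symm (b k)]
    rw [curvature_apply, map_sub, map_sub, hskew (b j) (b j), e1, e2, sub_neg_eq_add, add_sub_assoc,
      ← Finset.sum_sub_distrib]
    congr 1
    exact Finset.sum_congr rfl fun k _ ↦ by ring
  simp_rw [hterm, Finset.sum_add_distrib]
  have hz : ∑ j, ∑ i, -g (D (b j) (b j)) (D (b i) (b i)) = 0 := by
    simp_rw [Finset.sum_neg_distrib, ← map_sum, hH]
    simp
  rw [hz, zero_add]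
  have h1 : ∑ j, ∑ i, ∑ k, (w i j k * w j i k - w j i k * w k i j) = 0 := by
    -- Antisymmetry in the last two indices writes the summand as a difference of two cyclic
    -- relabellings of one expression.
    have h2 : ∀ j i k, w i j k * w j i k - w j i k * w k i j =
        w j k i * w k i j - w i j k * w j k i := by
      intro j i k
      rw [hwskew j i k]
      ring
    simp_rw [h2, Finset.sum_sub_distrib]
    rw [sub_eq_zero, Finset.sum_comm, Finset.sum_comm (f := fun j i ↦ ∑ k, w i j k * w j k i)]
    exact sum_cyclic fun i j k ↦ w i j k * w j k i
  rw [h1, zero_add, Finset.sum_comm]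
  refine (sum_cyclic fun i j k ↦ w i j k * w k i j).symm.trans ?_
  exact Finset.sum_congr rfl fun i _ ↦ Finset.sum_congr rfl fun j _ ↦
    Finset.sum_congr rfl fun k _ ↦ mul_comm _ _

end Flat
-- Hano's theorem in the solvable case
section Solvable

variable {L : Type*} [LieRing L] [LieAlgebra ℝ L] {g : LinearMap.BilinForm ℝ L}
variable {D : L →ₗ[ℝ] L →ₗ[ℝ] L} {ι : Type*} [Fintype ι] {b : Module.Basis ι ℝ L}

/-- If `c` are structure constants, `w` the connection coefficients given by the Koszul formula,
and `c i j k = 0` whenever `k` has minimal level among `i, j, k`, then vanishing of the scalar curvature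
forces `w i j k = 0` except when `i` has strictly minimal level. -/
theorem level_lt_of_sum_eq_zero {ι : Type*} [Fintype ι] {c w : ι → ι → ι → ℝ} {ℓ : ι → ℕ}
    (hw : ∀ i j k, 2 * w i j k = c i j k - c j k i + c k i j)
    (hc : ∀ i j k, ℓ k ≤ ℓ i → ℓ k ≤ ℓ j → c i j k = 0)
    (hsum : ∑ i, ∑ j, ∑ k, w i j k * w j k i = 0) {i j k : ι} (h : w i j k ≠ 0) :
    ℓ i < ℓ j ∧ ℓ i < ℓ k := by
  let F : ι → ι → ι → ℝ := fun i j k ↦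
    w i j k * w j k i + w j k i * w k i j + w k i j * w i j k
  -- When `k` has minimal level, w j k i = -w i j k; the two terms of `F` containing w k i j cancel,
  -- leaving minus a square.
  have hF : ∀ i j k, ℓ k ≤ ℓ i → ℓ k ≤ ℓ j → F i j k = -(w i j k) ^ 2 ∧ w j k i = -w i j k := by
    intro i j k h1 h2
    have h3 := hw i j k
    have h4 := hw j k i
    rw [hc i j k h1 h2] at h3 h4
    have h5 : w j k i = -w i j k := by linarith
    refine ⟨?_, h5⟩
    simp only [F, h5]
    ring
  have hcyc : ∀ i j k, F j k i = F i j k := fun i j k ↦ by simp only [F]; ring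
  have hmin : ∀ i j k, (ℓ k ≤ ℓ i ∧ ℓ k ≤ ℓ j) ∨ (ℓ i ≤ ℓ j ∧ ℓ i ≤ ℓ k) ∨
      (ℓ j ≤ ℓ k ∧ ℓ j ≤ ℓ i) := fun i j k ↦ by omega
  have hle : ∀ i j k, F i j k ≤ 0 := by
    intro i j k
    rcases hmin i j k with h | h | h
    · rw [(hF i j k h.1 h.2).1]
      exact neg_nonpos.mpr (sq_nonneg _)
    · rw [← hcyc i j k, (hF j k i h.1 h.2).1]
      exact neg_nonpos.mpr (sq_nonneg _)
    · rw [← hcyc i j k, ← hcyc j k i, (hF k i j h.1 h.2).1]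
      exact neg_nonpos.mpr (sq_nonneg _)
  have hF0 : ∑ i, ∑ j, ∑ k, F i j k = 0 := by
    simp only [F, Finset.sum_add_distrib]
    have h1 := sum_cyclic fun i j k ↦ w i j k * w j k i
    have h2 := sum_cyclic fun i j k ↦ w j k i * w k i j
    rw [h2, h1, hsum]
    norm_num
  have hzero : ∀ i j k, F i j k = 0 := by
    intro i j k
    have h1 := (Finset.sum_eq_zero_iff_of_nonpos fun i _ ↦ Finset.sum_nonpos fun j _ ↦
      Finset.sum_nonpos fun k _ ↦ hle i j k).mp hF0 i (Finset.mem_univ i)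
    have h2 := (Finset.sum_eq_zero_iff_of_nonpos fun j _ ↦
      Finset.sum_nonpos fun k _ ↦ hle i j k).mp h1 j (Finset.mem_univ j)
    exact (Finset.sum_eq_zero_iff_of_nonpos fun k _ ↦ hle i j k).mp h2 k (Finset.mem_univ k)
  have hthird : ∀ i j k, ℓ k ≤ ℓ i → ℓ k ≤ ℓ j → w i j k = 0 ∧ w j k i = 0 := by
    intro i j k h1 h2
    have h3 := hF i j k h1 h2
    rw [hzero, eq_comm, neg_eq_zero, pow_eq_zero_iff two_ne_zero] at h3
    exact ⟨h3.1, by rw [h3.2, h3.1, neg_zero]⟩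
  by_contra hcon
  rcases hmin i j k with h1 | h1 | h1
  · exact h (hthird i j k h1.1 h1.2).1
  · rcases Nat.lt_or_ge (ℓ i) (ℓ j) with h2 | h2
    · have h3 : ℓ k ≤ ℓ i := by omega
      exact h (hthird i j k h3 (by omega)).1
    · exact h (hthird k i j (by omega) h2).2
  · exact h (hthird k i j h1.1 h1.2).2

/-- Let V_p be spanned by the basis vectors of level p. The hypothesis says that D along V_p
preserves V_q, and is zero there when q ≤ p. Hence D x y = [x, y] for p ≤ q, and the curvature
either vanishes term by term or is a Jacobi expression. -/
theorem IsLeviCivita.isFlat_of_level (hg : IsInnerProduct g) (hLC : IsLeviCivita g D)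
    (hb : IsOrthonormalBasis g b) {ℓ : ι → ℕ}
    (hw : ∀ i j k, g (D (b i) (b j)) (b k) ≠ 0 → ℓ i < ℓ j ∧ ℓ j = ℓ k) : IsFlat g := by
  let V : ℕ → Submodule ℝ L := fun p ↦ Submodule.span ℝ (b '' {i | ℓ i = p})
  have hbV : ∀ i, b i ∈ V (ℓ i) := fun i ↦ Submodule.subset_span ⟨i, rfl, rfl⟩
  have hDb : ∀ i j, D (b i) (b j) ∈ V (ℓ j) := by
    intro i j
    rw [← hb.sum_smul (D (b i) (b j))]
    refine Submodule.sum_mem _ fun k _ ↦ ?_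
    rw [hg.symm]
    by_cases h : g (D (b i) (b j)) (b k) = 0
    · rw [h, zero_smul]
      exact Submodule.zero_mem _
    · rw [(hw i j k h).2]
      exact Submodule.smul_mem _ _ (hbV k)
  have hDb0 : ∀ i j, ℓ j ≤ ℓ i → D (b i) (b j) = 0 := by
    intro i j hij
    rw [← hb.sum_smul (D (b i) (b j))]
    refine Finset.sum_eq_zero fun k _ ↦ ?_
    rw [hg.symm]
    by_cases h : g (D (b i) (b j)) (b k) = 0
    · rw [h, zero_smul]
    · exact absurd (hw i j k h).1 (not_lt.mpr hij)
  have hmem : ∀ i q, ∀ y ∈ V q, D (b i) y ∈ V q := by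
    intro i q y hy
    have : V q ≤ (V q).comap (D (b i)) := by
      refine Submodule.span_le.mpr ?_
      rintro _ ⟨j, rfl, rfl⟩
      exact hDb i j
    exact this hy
  have hzero : ∀ p q, q ≤ p → ∀ x ∈ V p, ∀ y ∈ V q, D x y = 0 := by
    intro p q hqp x hx y hy
    refine Submodule.span_induction₂ (p := fun x y _ _ ↦ D x y = 0) ?_ ?_ ?_ ?_ ?_ ?_ ?_ hx hy
    · rintro _ _ ⟨i, rfl, rfl⟩ ⟨j, rfl, rfl⟩
      exact hDb0 i j hqp
    · simp
    · simp
    · intro x y z _ _ _ h1 h2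
      simp [h1, h2]
    · intro x y z _ _ _ h1 h2
      simp [h1, h2]
    · intro r x y _ _ h
      simp [h]
    · intro r x y _ _ h
      simp [h]
  have hlie : ∀ p q, p ≤ q → ∀ x ∈ V p, ∀ y ∈ V q, ⁅x, y⁆ = D x y := by
    intro p q hpq x hx y hy
    rw [← hLC.torsion_free, hzero q p hpq y hy x hx, sub_zero]
  have hkey : ∀ i j k, ℓ i ≤ ℓ j → curvature D (b i) (b j) (b k) = 0 := by
    intro i j k hij
    have hij' : ⁅b i, b j⁆ ∈ V (ℓ j) := by
      rw [hlie _ _ hij _ (hbV i) _ (hbV j)]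
      exact hDb i j
    rw [curvature_apply]
    rcases Nat.lt_or_ge (ℓ j) (ℓ k) with hk | hk
    · rw [← hlie (ℓ j) (ℓ k) hk.le _ hij' _ (hbV k),
        ← hlie _ _ hk.le _ (hbV j) _ (hbV k), ← hlie _ _ (hij.trans hk.le) _ (hbV i) _ (hbV k)]
      have h1 : ∀ m, ℓ m ≤ ℓ k → ⁅b m, b k⁆ ∈ V (ℓ k) := by
        intro m hm
        rw [hlie _ _ hm _ (hbV m) _ (hbV k)]
        exact hDb m k
      rw [← hlie _ _ (hij.trans hk.le) _ (hbV i) _ (h1 j hk.le),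
        ← hlie _ _ hk.le _ (hbV j) _ (h1 i (hij.trans hk.le)), lie_lie, sub_self]
    · rw [hzero _ _ hk _ (hbV j) _ (hbV k), hzero _ _ hk _ hij' _ (hbV k),
        hzero _ _ hk _ (hbV j) _ (hDb i k)]
      simp
  refine ⟨D, hLC, fun x y z ↦ ?_⟩
  have hbasis : ∀ i j k, curvature D (b i) (b j) (b k) = 0 := by
    intro i j k
    rcases le_total (ℓ i) (ℓ j) with h | h
    · exact hkey i j k h
    · rw [curvature_skew, hkey j i k h, neg_zero]
  let R : L →ₗ[ℝ] L →ₗ[ℝ] L →ₗ[ℝ] L := LinearMap.mk₂ ℝ (curvature D)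
    (fun x x' y ↦ by
      ext z; simp only [curvature_apply, add_lie, map_add, LinearMap.add_apply]; abel)
    (fun c x y ↦ by
      ext z; simp only [curvature_apply, smul_lie, map_smul, LinearMap.smul_apply, smul_sub])
    (fun x y y' ↦ by
      ext z; simp only [curvature_apply, lie_add, map_add, LinearMap.add_apply]; abel)
    (fun c x y ↦ by
      ext z; simp only [curvature_apply, lie_smul, map_smul, LinearMap.smul_apply, smul_sub])
  have hR : R = 0 := b.ext fun i ↦ b.ext fun j ↦ b.ext fun k ↦ hbasis i j k
  exact LinearMap.congr_fun (LinearMap.congr_fun (LinearMap.congr_fun hR x) y) z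

/-- **Hano's theorem** for solvable Lie algebras: a unimodular solvable Kähler Lie algebra is
flat. -/
theorem IsKahler.isFlat [FiniteDimensional ℝ L] [LieAlgebra.IsSolvable L] {J : L →ₗ[ℝ] L}
    (hK : IsKahler g J) (hu : IsUnimodular L) : IsFlat g := by
  have hg := hK.inner
  obtain ⟨D, hD⟩ := hg.exists_isKoszul
  obtain ⟨N, hN⟩ := LieAlgebra.IsSolvable.solvable ℝ L
  obtain ⟨ι, _, b, ℓ, hb, hmem, horth⟩ := hg.exists_adapted_basis
    (fun p ↦ (LieAlgebra.derivedSeries ℝ L p).toSubmodule)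
    (fun p q h ↦ LieAlgebra.derivedSeriesOfIdeal_antitone ⊤ h) (by simp) (N := N) (by simp [hN])
  have hLC := hD.isLeviCivita hg
  have hsum := hK.scalar_curvature hu hD hb
  rw [hD.scalar_eq hg hu hb] at hsum
  have hlt := @level_lt_of_sum_eq_zero ι _ (fun i j k ↦ g ⁅b i, b j⁆ (b k))
    (fun i j k ↦ g (D (b i) (b j)) (b k)) ℓ (fun i j k ↦ hD _ _ _) (fun i j k hi hj ↦ by
      rw [hg.symm]
      refine horth k _ ?_
      have hanti : ∀ m, ℓ k ≤ ℓ m → b m ∈ LieAlgebra.derivedSeries ℝ L (ℓ k) := fun m hm ↦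
        LieAlgebra.derivedSeriesOfIdeal_antitone ⊤ hm (hmem m)
      change ⁅b i, b j⁆ ∈ LieAlgebra.derivedSeries ℝ L (ℓ k + 1)
      rw [LieAlgebra.derivedSeries_def, LieAlgebra.derivedSeriesOfIdeal_succ]
      exact LieSubmodule.lie_mem_lie (hanti i hi) (hanti j hj)) hsum
  -- Here D (b j) (b i) contributes nothing, so the coefficient is that of the bracket, which stays
  -- in the ideal containing `b j`. Metric skewness in `j`, `k` then upgrades the inequality to
  -- equality.
  have hge : ∀ i j k, g (D (b i) (b j)) (b k) ≠ 0 → ℓ j ≤ ℓ k := by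
    intro i j k h
    by_contra hlt'
    have hij := (hlt h).1
    have h0 : g (D (b j) (b i)) (b k) = 0 := by
      by_contra h1
      exact absurd (hlt h1).1 hij.not_gt
    have h1 : g ⁅b i, b j⁆ (b k) = 0 := by
      rw [hg.symm]
      refine horth k _ ?_
      exact LieAlgebra.derivedSeriesOfIdeal_antitone ⊤ (Nat.lt_of_not_le hlt')
        (lie_mem_right ℝ L _ _ _ (hmem j))
    apply h
    rw [← hLC.torsion_free, map_sub, LinearMap.sub_apply, h0, sub_zero] at h1
    exact h1
  refine hLC.isFlat_of_level hg hb (ℓ := ℓ) fun i j k h ↦ ⟨(hlt h).1, le_antisymm (hge i j k h) ?_⟩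
  refine hge i k j fun h1 ↦ h ?_
  have := hLC.metric (b i) (b j) (b k)
  rw [hg.symm (b j), h1, add_zero] at this
  exact this

end Solvable
-- Centrality of the Reeb vector
section Sasakian

variable {L : Type*} [LieRing L] [LieAlgebra ℝ L] {g : LinearMap.BilinForm ℝ L}
variable {φ : L →ₗ[ℝ] L} {ξ : L} {η : L →ₗ[ℝ] ℝ}

theorem IsAlmostContactMetric.phi_xi (h : IsAlmostContactMetric g φ ξ η) : φ ξ = 0 := by
  have h1 : φ (φ ξ) = 0 := by rw [h.phi_sq, h.eta_xi, one_smul, neg_add_cancel]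
  have h2 := h.phi_sq (φ ξ)
  rw [h1, map_zero] at h2
  have h3 : φ ξ = η (φ ξ) • ξ := by
    rw [← sub_eq_zero, ← neg_eq_zero, h2]
    abel
  have h4 : η (φ ξ) * η (φ ξ) = 0 := by
    have h5 := congrArg (fun v ↦ η (φ v)) h3
    simp only [h1, map_zero, map_smul, smul_eq_mul] at h5
    exact h5.symm
  rw [h3, mul_self_eq_zero.mp h4, zero_smul]

theorem IsAlmostContactMetric.inner_xi (h : IsAlmostContactMetric g φ ξ η) (x : L) :
    g x ξ = η x := by
  have h1 := h.compat x ξ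
  rw [h.phi_xi, map_zero, h.eta_xi] at h1
  linarith

theorem IsAlmostContactMetric.eta_phi (h : IsAlmostContactMetric g φ ξ η) (x : L) :
    η (φ x) = 0 := by
  have h1 := h.phi_sq (φ x)
  rw [h.phi_sq x, map_add, map_neg, map_smul, h.phi_xi, smul_zero, add_zero] at h1
  have h2 : η (φ x) • ξ = 0 := by
    exact left_eq_add.mp h1
  have h3 := congrArg η h2
  rwa [map_smul, h.eta_xi, smul_eq_mul, mul_one, map_zero] at h3

theorem IsAlmostContactMetric.skew (h : IsAlmostContactMetric g φ ξ η) (x y : L) :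
    g (φ x) y = -g x (φ y) := by
  have h1 := h.compat x (φ y)
  rw [h.phi_sq, h.eta_phi, map_add, map_neg, map_smul, h.inner_xi, h.eta_phi] at h1
  simp only [smul_zero, mul_zero, add_zero, sub_zero] at h1
  linarith

theorem IsSasakian.eta_lie (h : IsSasakian g φ ξ η) (x y : L) : η ⁅x, y⁆ = g (φ x) y := by
  have := h.d_eta x y
  simp only [d₁, fundamentalForm] at this
  linarith

theorem IsSasakian.eta_lie_xi (h : IsSasakian g φ ξ η) (x : L) : η ⁅x, ξ⁆ = 0 := by
  rw [h.eta_lie, h.inner_xi, h.eta_phi]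

theorem IsSasakian.phi_lie_xi (h : IsSasakian g φ ξ η) (x : L) : φ ⁅x, ξ⁆ = ⁅φ x, ξ⁆ := by
  have h1 := h.normal x ξ
  simp only [nijenhuis, d₁, h.phi_xi, lie_zero, add_zero, zero_add, h.eta_lie_xi, neg_zero,
    zero_smul] at h1
  rw [← map_sub] at h1
  have h2 := h.phi_sq (φ ⁅x, ξ⁆ - ⁅φ x, ξ⁆)
  rw [h1, map_zero, map_sub, h.eta_phi, h.eta_lie_xi, sub_zero, zero_smul, add_zero] at h2
  exact sub_eq_zero.mp (neg_eq_zero.mp h2.symm)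

/-- The Reeb vector field of a Sasakian Lie algebra is Killing. -/
theorem IsSasakian.ad_xi_skew (h : IsSasakian g φ ξ η) (x y : L) :
    g ⁅ξ, x⁆ y = -g x ⁅ξ, y⁆ := by
  have hcomm : ∀ u, φ ⁅ξ, u⁆ = ⁅ξ, φ u⁆ := fun u ↦ by
    rw [← lie_skew, map_neg, h.phi_lie_xi, lie_skew]
  have h0 : ∀ u, η ⁅ξ, u⁆ = 0 := fun u ↦ by
    rw [← lie_skew, map_neg, h.eta_lie_xi, neg_zero]
  -- This is η([ξ, [u, y]]) = 0 expanded by Leibniz; putting u = φx then reaches every x modulo ξ.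
  have h1 : ∀ u, g ⁅ξ, φ u⁆ y = -g (φ u) ⁅ξ, y⁆ := by
    intro u
    have h2 := h0 ⁅u, y⁆
    rw [leibniz_lie, map_add, h.eta_lie, h.eta_lie, hcomm] at h2
    linarith
  have h2 := h1 (φ x)
  rw [h.phi_sq] at h2
  simp only [lie_add, lie_neg, lie_smul, lie_self, smul_zero, add_zero, map_neg, map_add,
    LinearMap.neg_apply, LinearMap.add_apply, map_smul, LinearMap.smul_apply] at h2
  rw [h.inner.symm ξ, h.inner_xi, h0, smul_zero, add_zero] at h2
  linarith

variable [FiniteDimensional ℝ L]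

/-- If the Reeb vector of a unimodular Sasakian Lie algebra is detected by a closed 1-form, then
`φ = 0`. -/
theorem IsSasakian.phi_eq_zero_of_closed (h : IsSasakian g φ ξ η) (hu : IsUnimodular L)
    {α : L →ₗ[ℝ] ℝ} (hα : ∀ x y : L, α ⁅x, y⁆ = 0) (hαξ : α ξ = 1) : φ = 0 := by
  obtain ⟨ι, _, b, hb⟩ := h.inner.exists_basis
  let v : L := ∑ i, (η (b i) - α (b i)) • b i
  have hv : ∀ y, g v y = η y - α y := by
    intro y
    conv_rhs => rw [← hb.sum_smul y]
    simp only [v, map_sum, LinearMap.sum_apply, map_smul, LinearMap.smul_apply, smul_eq_mul]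
    rw [← Finset.sum_sub_distrib]
    exact Finset.sum_congr rfl fun i _ ↦ by ring
  have hηv : η v = 0 := by rw [← h.inner_xi, hv, h.eta_xi, hαξ, sub_self]
  -- Chosen so that η([z, ·]) = η - α. As α kills brackets, ad z then preserves the form ⟨φx, y⟩ up
  -- to the factor 1 (`hA`).
  let z : L := -φ v
  have hz : ∀ y, η ⁅z, y⁆ = η y - α y := by
    intro y
    rw [h.eta_lie, ← hv, map_neg, h.phi_sq, hηv, zero_smul, add_zero, neg_neg]
  have hA : ∀ x y, g (φ ⁅z, x⁆) y + g (φ x) ⁅z, y⁆ = g (φ x) y := by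
    intro x y
    rw [← h.eta_lie, ← h.eta_lie, ← h.eta_lie, ← map_add, ← leibniz_lie, hz, hα, sub_zero]
  have htr : ∑ i, g (b i) ⁅z, b i⁆ = 0 := by
    have := hu z
    rwa [hb.trace_eq] at this
  have hzξ : η ⁅z, ξ⁆ = 0 := h.eta_lie_xi z
  have h1 : ∑ i, g (φ ⁅z, b i⁆) (φ (b i)) = 0 := by
    simp_rw [h.compat]
    rw [Finset.sum_sub_distrib, Finset.sum_congr rfl fun i _ ↦ h.inner.symm ⁅z, b i⁆ (b i), htr]
    have h2 : ∑ i, η ⁅z, b i⁆ * η (b i) = η ⁅z, ∑ i, g (b i) ξ • b i⁆ := by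
      simp only [lie_sum, map_sum, lie_smul, map_smul, h.inner_xi, smul_eq_mul, mul_comm]
    rw [h2, hb.sum_smul, hzξ, sub_zero]
  have h2 : ∑ i, g (φ (b i)) ⁅z, φ (b i)⁆ = 0 := by
    have h3 := hb.sum_skew h.skew h.inner (g.compl₂ (LieAlgebra.ad ℝ L z ∘ₗ φ))
    simp only [LinearMap.compl₂_apply, LinearMap.comp_apply, LieAlgebra.ad_apply, h.phi_sq,
      map_add, map_neg, map_smul, Finset.sum_add_distrib,
      Finset.sum_neg_distrib, htr, smul_eq_mul] at h3
    have h4 : ∑ i, η (b i) * g (b i) ⁅z, ξ⁆ = 0 := by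
      simp_rw [← h.inner_xi]
      rw [hb.sum_mul, h.inner.symm, h.inner_xi, hzξ]
    rw [h3, h4]
    simp
  -- Putting y = φx in `hA` and summing over the basis writes ‖φ‖² as two sums, both zero because ad
  -- z is traceless.
  have h3 : ∑ i, g (φ (b i)) (φ (b i)) = 0 := by
    rw [Finset.sum_congr rfl fun i _ ↦ (hA (b i) (φ (b i))).symm, Finset.sum_add_distrib, h1, h2, add_zero]
  refine b.ext fun i ↦ ?_
  exact h.inner.eq_zero_of_self ((Finset.sum_eq_zero_iff_of_nonneg fun j _ ↦
    h.inner.self_nonneg _).mp h3 i (Finset.mem_univ i))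

/-- The Reeb vector of a unimodular solvable Sasakian Lie algebra is central. -/
theorem IsSasakian.lie_xi [LieAlgebra.IsSolvable L] (h : IsSasakian g φ ξ η)
    (hu : IsUnimodular L) (x : L) : ⁅ξ, x⁆ = 0 := by
  by_cases hξ : ξ ∈ LieAlgebra.derivedSeries ℝ L 1
  · obtain ⟨ι, _, b, hb⟩ := h.inner.exists_basis
    have hnil := isNilpotent_ad_of_mem_derivedSeries_one hξ
    have hnil2 : IsNilpotent (LieAlgebra.ad ℝ L ξ ∘ₗ LieAlgebra.ad ℝ L ξ) :=
      Commute.isNilpotent_mul_left (Commute.refl _) hnil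
    have htr := (LinearMap.isNilpotent_trace_of_isNilpotent hnil2).eq_zero
    rw [hb.trace_eq] at htr
    -- By skewness the trace of (ad ξ)² is minus the sum of |[ξ, bᵢ]|², while nilpotency makes it
    -- zero.
    have h1 : ∀ i, g (b i) ((LieAlgebra.ad ℝ L ξ ∘ₗ LieAlgebra.ad ℝ L ξ) (b i)) =
        -g ⁅ξ, b i⁆ ⁅ξ, b i⁆ := by
      intro i
      rw [LinearMap.comp_apply, LieAlgebra.ad_apply, LieAlgebra.ad_apply, h.ad_xi_skew, neg_neg]
    simp_rw [h1] at htr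
    rw [Finset.sum_neg_distrib, neg_eq_zero, Finset.sum_eq_zero_iff_of_nonneg fun j _ ↦
      h.inner.self_nonneg _] at htr
    have h2 : LieAlgebra.ad ℝ L ξ = 0 :=
      b.ext fun i ↦ h.inner.eq_zero_of_self (htr i (Finset.mem_univ i))
    exact LinearMap.congr_fun h2 x
  · obtain ⟨f, hf, hle⟩ := Submodule.exists_le_ker_of_notMem (K := ℝ)
      (p := (LieAlgebra.derivedSeries ℝ L 1).toSubmodule) hξ
    have hφ : φ = 0 := by
      refine h.phi_eq_zero_of_closed hu (α := (f ξ)⁻¹ • f) (fun x y ↦ ?_) ?_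
      · have h1 : ⁅x, y⁆ ∈ LieAlgebra.derivedSeries ℝ L 1 :=
          LieSubmodule.lie_mem_lie (LieSubmodule.mem_top x) (LieSubmodule.mem_top y)
        have h2 : f ⁅x, y⁆ = 0 := hle h1
        simp [h2]
      · simp [inv_mul_cancel₀ hf]
    -- With φ = 0 this reads x = η(x)ξ, which commutes with ξ.
    have h1 := h.phi_sq x
    rw [hφ, LinearMap.zero_apply] at h1
    rw [eq_comm, neg_add_eq_zero] at h1
    rw [h1, lie_smul, lie_self, smul_zero]

end Sasakian

/-! ### The Kähler quotient and the central extension -/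

section Quotient

/-- A Lie algebra `K` presented as the quotient of a Sasakian Lie algebra `L` by its central Reeb
vector `ξ`, with the linear section `s` whose image is the kernel of the contact form `η`. -/
structure IsReebQuotient {L K : Type*} [LieRing L] [LieAlgebra ℝ L] [LieRing K] [LieAlgebra ℝ K]
    (ξ : L) (η : L →ₗ[ℝ] ℝ) (π : L →ₗ⁅ℝ⁆ K) (s : K →ₗ[ℝ] L) : Prop where
  central : ∀ x : L, ⁅ξ, x⁆ = 0
  proj_section : ∀ x, π (s x) = x
  section_proj : ∀ x, s (π x) = x - η x • ξ

theorem exists_isReebQuotient {L : Type u} [LieRing L] [LieAlgebra ℝ L] {ξ : L} {η : L →ₗ[ℝ] ℝ}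
    (hξ : ∀ x : L, ⁅ξ, x⁆ = 0) (hη : η ξ = 1) :
    ∃ (K : Type u) (_ : LieRing K) (_ : LieAlgebra ℝ K) (π : L →ₗ⁅ℝ⁆ K) (s : K →ₗ[ℝ] L),
      IsReebQuotient ξ η π s := by
  let I : LieIdeal ℝ L :=
    { Submodule.span ℝ {ξ} with
      lie_mem := by
        rintro x m hm
        obtain ⟨c, rfl⟩ := Submodule.mem_span_singleton.mp hm
        rw [lie_smul, ← lie_skew, hξ, neg_zero, smul_zero]
        exact Submodule.zero_mem _ }
  let s : (L ⧸ I) →ₗ[ℝ] L := I.toSubmodule.liftQ (LinearMap.id - η.smulRight ξ) (by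
    intro m hm
    obtain ⟨c, rfl⟩ := Submodule.mem_span_singleton.mp hm
    simp [hη])
  have hs : ∀ x, s (LieSubmodule.Quotient.mk x) = x - η x • ξ := fun x ↦ rfl
  have hmem : ∀ c : ℝ, c • ξ ∈ I := fun c ↦ Submodule.mem_span_singleton.mpr ⟨c, rfl⟩
  let π : L →ₗ⁅ℝ⁆ L ⧸ I :=
    { I.toSubmodule.mkQ with map_lie' := fun {x y} ↦ rfl }
  have hπ : ∀ x, π x = LieSubmodule.Quotient.mk x := fun x ↦ rfl
  refine ⟨L ⧸ I, inferInstance, inferInstance, π, s, hξ, fun x ↦ ?_, fun x ↦ hs x⟩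
  obtain ⟨x, rfl⟩ := LieSubmodule.Quotient.surjective_mk' I x
  change π (s (LieSubmodule.Quotient.mk x)) = _
  rw [hs, map_sub, hπ, hπ, (LieSubmodule.Quotient.mk_eq_zero'.mpr (hmem _)), sub_zero]
  rfl

variable {L K : Type*} [LieRing L] [LieAlgebra ℝ L] [LieRing K] [LieAlgebra ℝ K]
  {ξ : L} {η : L →ₗ[ℝ] ℝ} {π : L →ₗ⁅ℝ⁆ K} {s : K →ₗ[ℝ] L}
  {g : LinearMap.BilinForm ℝ L} {φ : L →ₗ[ℝ] L}

theorem IsReebQuotient.surjective (h : IsReebQuotient ξ η π s) : Function.Surjective π :=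
  fun x ↦ ⟨s x, h.proj_section x⟩

theorem IsReebQuotient.proj_xi (h : IsReebQuotient ξ η π s) (hη : η ξ = 1) : π ξ = 0 := by
  have h1 := h.section_proj ξ
  rw [hη, one_smul, sub_self] at h1
  rw [← h.proj_section (π ξ), h1, map_zero]

theorem IsReebQuotient.eta_section (h : IsReebQuotient ξ η π s) (hη : η ξ = 1) (x : K) :
    η (s x) = 0 := by
  rw [← h.proj_section x, h.section_proj, map_sub, map_smul, hη]
  simp

theorem IsReebQuotient.section_lie (h : IsReebQuotient ξ η π s) (x y : K) :
    s ⁅x, y⁆ = ⁅s x, s y⁆ - η ⁅s x, s y⁆ • ξ := by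
  rw [← h.section_proj, LieHom.map_lie, h.proj_section, h.proj_section]

theorem IsReebQuotient.lie_xi (h : IsReebQuotient ξ η π s) (x : L) : ⁅x, ξ⁆ = 0 := by
  rw [← lie_skew, h.central, neg_zero]

/-- The trace of ad_x on `K` is that of ad(sx) ∘ s ∘ π on `L`, and s ∘ π differs from the identity
only by multiples of the central ξ. -/
theorem IsReebQuotient.isUnimodular [FiniteDimensional ℝ L] (h : IsReebQuotient ξ η π s)
    (hu : IsUnimodular L) : IsUnimodular K := by
  intro x
  have h1 : LieAlgebra.ad ℝ K x = (π : L →ₗ[ℝ] K) ∘ₗ LieAlgebra.ad ℝ L (s x) ∘ₗ s := by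
    ext y
    change ⁅x, y⁆ = π ⁅s x, s y⁆
    rw [LieHom.map_lie, h.proj_section, h.proj_section]
  have h2 : (LieAlgebra.ad ℝ L (s x) ∘ₗ s) ∘ₗ (π : L →ₗ[ℝ] K) = LieAlgebra.ad ℝ L (s x) := by
    ext y
    change ⁅s x, s (π y)⁆ = ⁅s x, y⁆
    rw [h.section_proj, lie_sub, lie_smul, h.lie_xi, smul_zero, sub_zero]
  have : FiniteDimensional ℝ K := Module.Finite.of_surjective (π : L →ₗ[ℝ] K) h.surjective
  rw [h1, LinearMap.trace_comp_comm', h2, hu]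

/-- The transverse Kähler structure of a Sasakian Lie algebra with central Reeb vector. -/
theorem IsReebQuotient.isKahler (h : IsReebQuotient ξ η π s) (hS : IsSasakian g φ ξ η) :
    IsKahler (g.compl₁₂ s s) ((π : L →ₗ[ℝ] K) ∘ₗ φ ∘ₗ s) := by
  have hηs := h.eta_section hS.eta_xi
  have hπξ := h.proj_xi hS.eta_xi
  set J : K →ₗ[ℝ] K := (π : L →ₗ[ℝ] K) ∘ₗ φ ∘ₗ s with hJ
  have hsJ : ∀ x, s (J x) = φ (s x) := by
    intro x
    change s (π (φ (s x))) = _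
    rw [h.section_proj, hS.eta_phi, zero_smul, sub_zero]
  have hJπ : ∀ x, J (π x) = π (φ x) := by
    intro x
    change π (φ (s (π x))) = _
    rw [h.section_proj, map_sub, map_smul, hS.phi_xi, smul_zero, sub_zero]
  have hω : ∀ x y, fundamentalForm (g.compl₁₂ s s) J x y = η ⁅s x, s y⁆ := by
    intro x y
    rw [hS.eta_lie, fundamentalForm, LinearMap.compl₁₂_apply, hsJ]
  refine ⟨⟨fun x y ↦ hS.inner.symm _ _, fun x hx ↦ hS.inner.pos _ fun h0 ↦ hx ?_⟩, fun x ↦ ?_,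
    fun x y ↦ ?_, fun x y ↦ ?_, fun x y z ↦ ?_⟩
  · rw [← h.proj_section x, h0, map_zero]
  · change π (φ (s (J x))) = -x
    rw [hsJ, hS.phi_sq, hηs, zero_smul, add_zero, map_neg, h.proj_section]
  · have h1 := congrArg π (hS.normal (s x) (s y))
    rw [map_neg, map_smul, hπξ, smul_zero, neg_zero] at h1
    rw [← h1]
    simp only [nijenhuis, map_sub, map_add, LieHom.map_lie, ← hJπ, h.proj_section]
  · rw [LinearMap.compl₁₂_apply, hsJ, hsJ, hS.compat, hηs, zero_mul, sub_zero,
      LinearMap.compl₁₂_apply]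
  -- Closedness is η applied to the Jacobi identity: the ξ-correction in s[x, y] drops out by
  -- centrality.
  · have h1 : ∀ x y z, fundamentalForm (g.compl₁₂ s s) J ⁅x, y⁆ z = -η ⁅s z, ⁅s x, s y⁆⁆ := by
      intro x y z
      rw [hω, h.section_lie, sub_lie, smul_lie, h.central, smul_zero, sub_zero, ← lie_skew, map_neg]
    simp only [d₂, h1]
    have h2 := congrArg η (lie_jacobi (s x) (s y) (s z))
    simp only [map_add, map_zero] at h2
    linarith

/-- The 2-cocycle of the extension `L → K`. -/
theorem IsReebQuotient.exists_cocycle (h : IsReebQuotient ξ η π s) :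
    ∃ β : ClosedTwoForm K, ∀ x y, ClosedTwoForm.eval β x y = η ⁅s x, s y⁆ := by
  let B : K →ₗ[ℝ] K →ₗ[ℝ] ℝ :=
    ((LieModule.toEnd ℝ L L : L →ₗ[ℝ] Module.End ℝ L).compl₁₂ s s).compr₂ η
  have hB : ∀ x y, B x y = η ⁅s x, s y⁆ := fun x y ↦ rfl
  let c : LieModule.Cohomology.twoCochain ℝ K (TrivialLieModule ℝ K ℝ) :=
    ⟨B.compr₂ (TrivialLieModule.equiv ℝ K ℝ).symm.toLinearMap, fun x ↦ by
      change B x x = 0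
      rw [hB, lie_self, map_zero]⟩
  refine ⟨⟨c, ?_⟩, fun x y ↦ rfl⟩
  rw [LieModule.Cohomology.mem_twoCocycle_iff_of_trivial]
  intro x y z
  change B x ⁅y, z⁆ = B ⁅x, y⁆ z + B y ⁅x, z⁆
  simp only [hB, h.section_lie, lie_sub, sub_lie, lie_smul, smul_lie, h.lie_xi, h.central,
    smul_zero, sub_zero]
  rw [leibniz_lie, map_add]

/-- The splitting L = ker η ⊕ ℝξ gives coordinates (πx, η(x)); brackets match because centrality
lets x be replaced by s(πx) inside η([x, y]). -/
theorem IsReebQuotient.nonempty_equiv (h : IsReebQuotient ξ η π s) (hη : η ξ = 1)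
    {β : ClosedTwoForm K} (hβ : ∀ x y, ClosedTwoForm.eval β x y = η ⁅s x, s y⁆) :
    Nonempty (L ≃ₗ⁅ℝ⁆ CentralExtension β) := by
  let e : TrivialLieModule ℝ K ℝ ≃ₗ[ℝ] ℝ := TrivialLieModule.equiv ℝ K ℝ
  refine ⟨{ toFun := fun x ↦ LieAlgebra.ofProd β (π x, e.symm (η x))
            invFun := fun y ↦ s ((LieAlgebra.ofProd β).symm y).1 +
              e ((LieAlgebra.ofProd β).symm y).2 • ξ
            map_add' := fun x y ↦ ?_
            map_smul' := fun c x ↦ ?_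
            map_lie' := fun {x y} ↦ ?_
            left_inv := fun x ↦ ?_
            right_inv := fun y ↦ ?_ }⟩
  · simp [← LieAlgebra.of_add]
  · simp [← LieAlgebra.of_smul, -smul_eq_mul]
  · have h1 : η ⁅x, y⁆ = ClosedTwoForm.eval β (π x) (π y) := by
      rw [hβ, h.section_proj, h.section_proj]
      simp only [lie_sub, sub_lie, lie_smul, smul_lie, h.lie_xi, h.central, smul_zero, sub_zero]
    rw [LieAlgebra.bracket_ofTwoCocycle]
    refine congrArg _ (Prod.ext (LieHom.map_lie π x y) ?_)
    simp only [Equiv.symm_apply_apply, trivial_lie_zero, add_zero, sub_zero, h1]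
    rfl
  · simp [h.section_proj]
  · rw [← Equiv.eq_symm_apply]
    refine Prod.ext ?_ ?_
    · simp [h.proj_section, h.proj_xi hη]
    · simp [h.eta_section hη, hη]

end Quotient

end SasakiLie

theorem mainTheorem11 {𝔥 : Type u} [LieRing 𝔥] [LieAlgebra ℝ 𝔥] [FiniteDimensional ℝ 𝔥]
    [LieAlgebra.IsSolvable 𝔥] (hu : SasakiLie.IsUnimodular 𝔥)
    (hS : SasakiLie.AdmitsSasakian 𝔥) :
    LieAlgebra.center ℝ 𝔥 ≠ ⊥ ∧
    ∃ (𝔨 : Type u) (_ : LieRing 𝔨) (_ : LieAlgebra ℝ 𝔨)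
      (g : LinearMap.BilinForm ℝ 𝔨) (J : 𝔨 →ₗ[ℝ] 𝔨) (β : SasakiLie.ClosedTwoForm 𝔨),
      SasakiLie.IsKahler g J ∧ SasakiLie.IsFlat g ∧
      (∀ x y, SasakiLie.ClosedTwoForm.eval β x y = SasakiLie.fundamentalForm g J x y) ∧
      Nonempty (𝔥 ≃ₗ⁅ℝ⁆ SasakiLie.CentralExtension β) := by
  obtain ⟨g, φ, ξ, η, h⟩ := hS
  have hξ := h.lie_xi hu
  obtain ⟨K, _, _, π, s, hK⟩ := SasakiLie.exists_isReebQuotient hξ h.eta_xi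
  obtain ⟨β, hβ⟩ := hK.exists_cocycle
  have : FiniteDimensional ℝ K := Module.Finite.of_surjective (π : 𝔥 →ₗ[ℝ] K) hK.surjective
  have : LieAlgebra.IsSolvable K := hK.surjective.lieAlgebra_isSolvable
  have hKahler := hK.isKahler h
  refine ⟨fun h0 ↦ ?_, K, _, _, _, _, β, hKahler, hKahler.isFlat (hK.isUnimodular hu),
    fun x y ↦ ?_, hK.nonempty_equiv h.eta_xi hβ⟩
  · have h1 : ξ ∈ LieAlgebra.center ℝ 𝔥 := fun x ↦ hK.lie_xi x
    rw [h0, LieSubmodule.mem_bot] at h1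
    have h2 := h.eta_xi
    rw [h1, map_zero] at h2
    exact zero_ne_one h2
  · rw [hβ, h.eta_lie, SasakiLie.fundamentalForm, LinearMap.compl₁₂_apply]
    congr 2
    -- The image of φ lies in ker η, where s ∘ π is the identity.
    change φ (s x) = s (π (φ (s x)))
    rw [hK.section_proj, h.eta_phi, zero_smul, sub_zero]
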